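/- Let $N\ge 0$. For $n\ge 0$ let $\mathrm{UConf}(n,\mathbb R^N)$ be the unordered configuration space of $n$ distinct points in $\mathbb R^N$, i.e. the quotient by the symmetric group $\Sigma_n$ of the subspace of injective $n$-tuples in $(\mathbb R^N)^n$. Let $\Psi_n$ be the space of continuous maps $\varphi:\mathbb R\to\mathbb R\times\mathrm{UConf}(n,\mathbb R^N)$ of the form $\varphi(t)=(t,z(t))$, with the compact-open topology, and let $\mathrm{im}(\varphi)=\{(t,x): x\in z(t)\}\subset\mathbb R\times\mathbb R^N$. For $R\in\mathbb N$ put $P_R=[-\tfrac R2,\tfrac R2]\times[-\tfrac R2,\tfrac R2]^N$, and let $\Phi_N^N(R)$ be the quotient space of the disjoint union $\bigsqcup_{n\ge 0}\Psi_n$ by the equivalence relation $\varphi\sim_R\psi\iff \mathrm{im}(\varphi)\cap P_R=\mathrm{im}(\psi)\cap P_R$. The space of local images is the inverse limit $$\Phi_N^N=\lim_{R\in\mathbb N}\Phi_N^N(R)$$ along the restriction maps $\Phi_N^N(S)\to\Phi_N^N(R)$, $R\le S$. Then $\Phi_N^N$ is weakly equivalent to the $N$-sphere $S^N$, i.e.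 the two spaces are connected by a finite zigzag of weak homotopy equivalences (continuous maps inducing bijections on path components and on $\pi_n$ for all $n\ge1$ and all base points). -/

import Mathlib

/-! ## Weak homotopy equivalences -/

section WeakEquivalence

open scoped Topology Topology.Homotopy

/-- Postcomposition of an `n`-dimensional loop based at `x` with a continuous map `f`. -/
def GenLoop.pushforward {X Y : Type*} [TopologicalSpace X] [TopologicalSpace Y]
    (n : ℕ) (f : C(X, Y)) (x : X) (p : Ω^ (Fin n) X x) : Ω^ (Fin n) Y (f x) :=
  ⟨f.comp p.1, fun y hy => congrArg f (p.2 y hy)⟩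

/-- The map `π_n(X, x) → π_n(Y, f x)` induced by a continuous map `f`. -/
def HomotopyGroup.inducedMap {X Y : Type*} [TopologicalSpace X] [TopologicalSpace Y]
    (n : ℕ) (f : C(X, Y)) (x : X) : HomotopyGroup.Pi n X x → HomotopyGroup.Pi n Y (f x) :=
  Quotient.map (GenLoop.pushforward n f x)
    (fun _ _ h => ContinuousMap.HomotopicRel.comp_continuousMap h f)

/-- The map on sets of path components induced by a continuous map `f`. -/
def ZerothHomotopy.inducedMap {X Y : Type*} [TopologicalSpace X] [TopologicalSpace Y]
    (f : C(X, Y)) : ZerothHomotopy X → ZerothHomotopy Y :=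
  Quotient.map f (fun _ _ h => h.map f.continuous)

/-- A weak homotopy equivalence: a continuous map inducing a bijection on path components and on
all homotopy groups, at every base point. -/
def IsWeakHomotopyEquiv {X Y : Type*} [TopologicalSpace X] [TopologicalSpace Y]
    (f : C(X, Y)) : Prop :=
  Function.Bijective (ZerothHomotopy.inducedMap f) ∧
    ∀ n : ℕ, 1 ≤ n → ∀ x : X, Function.Bijective (HomotopyGroup.inducedMap n f x)

/-- Two spaces are weakly equivalent if they are connected by a finite zigzag of weak homotopy
equivalences, that is, related by the equivalence relation which these maps generate. -/
def WeaklyEquivalent (X Y : Type) [TopologicalSpace X] [TopologicalSpace Y] : Prop :=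
  Relation.EqvGen (fun A B : TopCat.{0} => ∃ f : C(A, B), IsWeakHomotopyEquiv f)
    (TopCat.of X) (TopCat.of Y)

end WeakEquivalence

/-! ## Configuration spaces -/

/-- The ordered configuration space of `n` points in `X`, a subspace of `X ^ n`. -/
abbrev Conf (n : ℕ) (X : Type) : Type :=
  {x : Fin n → X // Function.Injective x}

/-- Two ordered configurations are identified if they differ by a permutation of the indices. -/
def Conf.permSetoid (n : ℕ) (X : Type) : Setoid (Conf n X) where
  r x y := ∃ σ : Equiv.Perm (Fin n), ∀ i, y.1 i = x.1 (σ i)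
  iseqv :=
    { refl := fun _ => ⟨1, fun _ => rfl⟩
      symm := by
        rintro x y ⟨σ, h⟩
        exact ⟨σ.symm, fun i => by rw [h, Equiv.apply_symm_apply]⟩
      trans := by
        rintro x y z ⟨σ, h⟩ ⟨τ, k⟩
        exact ⟨τ.trans σ, fun i => by rw [k, h]; rfl⟩ }

/-- The unordered configuration space of `n` points in `X`, with the quotient topology. -/
def UConf (n : ℕ) (X : Type) : Type := Quotient (Conf.permSetoid n X)

instance UConf.instTopologicalSpace (n : ℕ) (X : Type) [TopologicalSpace X] :
    TopologicalSpace (UConf n X) :=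
  inferInstanceAs (TopologicalSpace (Quotient (Conf.permSetoid n X)))

/-- The set of the `n` points of an unordered configuration. -/
def UConf.points {n : ℕ} {X : Type} (c : UConf n X) : Set X :=
  Quotient.lift (s := Conf.permSetoid n X) (fun x => Set.range x.1)
    (by
      rintro x y ⟨σ, h⟩
      have hy : y.1 = x.1 ∘ σ := funext h
      change Set.range x.1 = Set.range y.1
      rw [hy, σ.surjective.range_comp])
    c

/-! ## Paths of configurations and local images -/

/-- Paths of configurations of `n` points in `X`, parametrised by all real times: continuous maps
`φ : ℝ → ℝ × UConf n X` of the form `φ t = (t, z t)`, with the compact-open topology. -/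
abbrev ConfPath (n : ℕ) (X : Type) [TopologicalSpace X] : Type :=
  {φ : C(ℝ, ℝ × UConf n X) // ∀ t, (φ t).1 = t}

/-- The image of a path of configurations, as a subset of space-time `ℝ × X`. -/
def ConfPath.image {n : ℕ} {X : Type} [TopologicalSpace X] (φ : ConfPath n X) : Set (ℝ × X) :=
  {p | ∃ t : ℝ, p.1 = (φ.1 t).1 ∧ p.2 ∈ (φ.1 t).2.points}

/-- Two paths of configurations, of possibly different numbers of points, are identified if their
images have the same intersection with `P`. -/
def ConfPath.sameOn {X : Type} [TopologicalSpace X] (P : Set (ℝ × X)) :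
    Setoid (Σ n : ℕ, ConfPath n X) where
  r φ ψ := φ.2.image ∩ P = ψ.2.image ∩ P
  iseqv := ⟨fun _ => rfl, Eq.symm, Eq.trans⟩

/-- Paths of configurations as seen inside `P`: the quotient of the disjoint union over `n` of the
spaces of paths of `n`-point configurations, with the quotient topology. -/
def PathGerm {X : Type} [TopologicalSpace X] (P : Set (ℝ × X)) : Type :=
  Quotient (ConfPath.sameOn P)

instance PathGerm.instTopologicalSpace {X : Type} [TopologicalSpace X] (P : Set (ℝ × X)) :
    TopologicalSpace (PathGerm P) :=
  inferInstanceAs (TopologicalSpace (Quotient (ConfPath.sameOn P)))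

/-- Restriction of what is seen inside `Q` to what is seen inside a smaller window `P`. -/
def PathGerm.restrict {X : Type} [TopologicalSpace X] {P Q : Set (ℝ × X)} (h : P ⊆ Q) :
    PathGerm Q → PathGerm P :=
  Quotient.map' (s₁ := ConfPath.sameOn Q) (s₂ := ConfPath.sameOn P) id
    (by
      intro φ ψ e
      change φ.2.image ∩ P = ψ.2.image ∩ P
      have e' : φ.2.image ∩ Q = ψ.2.image ∩ Q := e
      rw [← Set.inter_eq_self_of_subset_right h, ← Set.inter_assoc, e', Set.inter_assoc])

/-- The window `[-R/2, R/2] × B_R(0)` in space-time `ℝ × ℝ^N`, where `B_R(0)` is the cube with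
centre `0` and side `R`. -/
def window (N R : ℕ) : Set (ℝ × EuclideanSpace ℝ (Fin N)) :=
  {p | |p.1| ≤ (R : ℝ) / 2 ∧ ∀ i, |p.2 i| ≤ (R : ℝ) / 2}

theorem window_mono (N : ℕ) {R S : ℕ} (h : R ≤ S) : window N R ⊆ window N S := by
  have h' : (R : ℝ) / 2 ≤ (S : ℝ) / 2 := by
    have : (R : ℝ) ≤ S := by exact_mod_cast h
    linarith
  exact fun p hp => ⟨hp.1.trans h', fun i => (hp.2 i).trans h'⟩

/-- The space `Φ_N^N` of local images in `ℝ × ℝ^N`: the inverse limit over `R` of the spaces of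
paths of configurations in `ℝ^N` as seen inside the windows `[-R/2, R/2] × B_R(0)`. -/
abbrev LocalImages (N : ℕ) : Type :=
  {φ : (R : ℕ) → PathGerm (window N R) //
    ∀ (R S : ℕ) (h : R ≤ S), PathGerm.restrict (window_mono N h) (φ S) = φ R}

/-!
The space of local images is homotopy equivalent to the one-point compactification of `ℝ^N`, hence
to the sphere, and homotopy equivalences are weak homotopy equivalences.

The map from the one-point compactification sends a point `x` to the constant path at the
configuration `{x}` and `∞` to the empty path (`LocalImages.ofOnePoint`). It is continuous at `∞`
because a point outside of a window cannot be seen in it.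

For the map in the other direction (`LocalImages.isolatedPoint`), let `δ` be the largest number
`≤ 1` such that the configuration at time `0` has at most one point in the open ball of radius `δ`
about the origin (`separation`). It is positive and continuous, and depends only on the points in
the unit ball, hence only on the local image. If there is a point `x` in the ball of radius `δ`, the
local image is sent to `x / (δ - ‖x‖)`, otherwise to `∞`. Continuity is seen by embedding the
compactification in `ℝ^(N+1)`: there the value is `∞` plus a sum over *all* points of the
configuration, in which every point outside of the ball contributes zero
(`Conf.apply_isolatedPoint_range`).

Both composites are homotopic to the identity. On local images, slow the time down to a standstill
and simultaneously stretch the space radially, from the identity to the blow-up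
`x ↦ x / (δ - ‖x‖)` of the ball of radius `δ` (`LocalImages.stretch`). At the end the path is
constant and all points but the isolated one have disappeared at infinity. As the number of points
of a path is fixed, points may not really disappear; at each stage of the inverse limit, the blow-up
is therefore cut off so that it is an injective map of the whole space, which sends all points that
should disappear outside of the window. Stretching only moves points outwards, so what is seen in a
window afterwards is determined by what was seen in it before and by `δ`. The homotopy is continuous
because the product of a quotient map with the unit interval is a quotient map. On the one-point
compactification, the composite is `x ↦ x / (1 - ‖x‖)` on the unit ball and `∞` elsewhere, and
`x ↦ x / (1 - τ ‖x‖)` is a homotopy to it from the identity (`blowUpHomotopy`). All norms are sup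
norms, because the windows are cubes.

That a homotopy equivalence induces bijections on homotopy groups at all base points comes down to
the case of a self-map `h` homotopic to the identity. Such a map acts on generalized loops, up to
homotopy, as the transport along the track of the base point
(`GenLoop.transport_homotopic_pushforward`), and transport along a path is inverted by transport
along the reversed path (`GenLoop.transport_symm_transport`).
-/

/-! ### Transport of generalized loops along a path -/

section Transport

open scoped Topology Topology.Homotopy unitInterval

/-- The sup-norm distance of a point of the cube to the centre of the cube, scaled so that it is
`1` on the boundary. -/
noncomputable def Cube.radius {n : ℕ} (y : I^ (Fin n)) : ℝ :=
  ‖fun i => 2 * (y i : ℝ) - 1‖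

@[fun_prop]
theorem Cube.continuous_radius {n : ℕ} : Continuous (Cube.radius (n := n)) := by
  unfold Cube.radius
  fun_prop

theorem Cube.radius_le_one {n : ℕ} (y : I^ (Fin n)) : Cube.radius y ≤ 1 := by
  refine (pi_norm_le_iff_of_nonneg zero_le_one).2 fun i => ?_
  rw [Real.norm_eq_abs, abs_le]
  constructor <;> linarith [(y i).2.1, (y i).2.2]

theorem Cube.radius_eq_one {n : ℕ} {y : I^ (Fin n)} (hy : y ∈ Cube.boundary (Fin n)) :
    Cube.radius y = 1 := by
  refine le_antisymm (Cube.radius_le_one y) ?_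
  obtain ⟨i, hi⟩ := hy
  refine le_trans ?_ (norm_le_pi_norm _ i)
  rcases hi with hi | hi <;> norm_num [hi]

/-- Scaling of the cube by `κ` about its centre, with all coordinates clamped to `[0, 1]`. -/
noncomputable def Cube.scale {n : ℕ} (κ : ℝ) (y : I^ (Fin n)) : I^ (Fin n) :=
  fun i => Set.projIcc 0 1 zero_le_one (κ * ((y i : ℝ) - 1 / 2) + 1 / 2)

@[fun_prop]
theorem Cube.continuous_scale {n : ℕ} :
    Continuous fun q : ℝ × (I^ (Fin n)) => Cube.scale q.1 q.2 :=
  continuous_pi fun i => continuous_projIcc.comp (by fun_prop)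

theorem Cube.scale_one {n : ℕ} (y : I^ (Fin n)) : Cube.scale 1 y = y := by
  funext i
  have h : (1 * ((y i : ℝ) - 1 / 2) + 1 / 2) = y i := by ring
  rw [Cube.scale, h]
  exact Set.projIcc_val zero_le_one (y i)

theorem Cube.scale_mem_boundary {n : ℕ} {κ : ℝ} {y : I^ (Fin n)} (h : κ * Cube.radius y = 1) :
    Cube.scale κ y ∈ Cube.boundary (Fin n) := by
  have h1 : ¬ ‖κ • fun i => 2 * (y i : ℝ) - 1‖ < 1 := by
    rw [norm_smul, not_lt]
    exact h.symm.le.trans (mul_le_mul_of_nonneg_right (le_abs_self κ) (norm_nonneg _))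
  rw [pi_norm_lt_iff zero_lt_one, not_forall] at h1
  obtain ⟨i, hi⟩ := h1
  rw [not_lt, Pi.smul_apply, smul_eq_mul, Real.norm_eq_abs, le_abs] at hi
  refine ⟨i, ?_⟩
  rcases hi with hi | hi
  · exact Or.inr (Set.projIcc_of_right_le _ (by linarith))
  · exact Or.inl (Set.projIcc_of_le_left _ (by linarith))

/-- The map on the cube which is `p`, shrunk by the factor `κ`, on the inner cube, and which
follows `c` along the radii of the remaining collar. -/
noncomputable def Cube.collar {n : ℕ} {X : Type*} (κ : ℝ) (p : (I^ (Fin n)) → X) (c : ℝ → X)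
    (y : I^ (Fin n)) : X :=
  if κ * Cube.radius y ≤ 1 then p (Cube.scale κ y) else c (κ * Cube.radius y - 1)

theorem Cube.continuous_collar {n : ℕ} {A X : Type*} [TopologicalSpace A] [TopologicalSpace X]
    {κ : A → ℝ} {p : A → (I^ (Fin n)) → X} {c : A → ℝ → X} {y : A → I^ (Fin n)}
    (hκ : Continuous κ) (hp : Continuous fun q : A × (I^ (Fin n)) => p q.1 q.2)
    (hc : Continuous fun q : A × ℝ => c q.1 q.2) (hy : Continuous y)
    (hpc : ∀ a, ∀ y ∈ Cube.boundary (Fin n), p a y = c a 0) :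
    Continuous fun a => Cube.collar (κ a) (p a) (c a) (y a) := by
  have hs : Continuous fun a => Cube.scale (κ a) (y a) :=
    Cube.continuous_scale.comp (hκ.prodMk hy)
  refine Continuous.if_le (f := fun a => κ a * Cube.radius (y a))
    (g := fun _ => (1 : ℝ)) (hp.comp (continuous_id.prodMk hs))
    (hc.comp (by fun_prop : Continuous fun a => (a, κ a * Cube.radius (y a) - 1)))
    (by fun_prop) continuous_const ?_
  intro a ha
  rw [hpc _ _ (Cube.scale_mem_boundary ha), ha, sub_self]

theorem Cube.collar_one {n : ℕ} {X : Type*} (p : (I^ (Fin n)) → X) (c : ℝ → X)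
    (y : I^ (Fin n)) : Cube.collar 1 p c y = p y := by
  rw [Cube.collar, one_mul, if_pos (Cube.radius_le_one y), Cube.scale_one]

theorem Cube.collar_of_mem_boundary {n : ℕ} {X : Type*} {κ : ℝ} (hκ : 1 ≤ κ)
    {p : (I^ (Fin n)) → X} {c : ℝ → X} {y : I^ (Fin n)} (hy : y ∈ Cube.boundary (Fin n))
    (h : p y = c 0) : Cube.collar κ p c y = c (κ - 1) := by
  rcases hκ.eq_or_lt with rfl | hκ
  · rw [Cube.collar_one, h, sub_self]
  · rw [Cube.collar, Cube.radius_eq_one hy, mul_one, if_neg (not_le.2 hκ)]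

/-- The change of base point of a generalized loop along a path. -/
noncomputable def GenLoop.transport {n : ℕ} {X : Type*} [TopologicalSpace X] {x x' : X}
    (γ : Path x x') (p : Ω^ (Fin n) X x) : Ω^ (Fin n) X x' := by
  have hb : ∀ y ∈ Cube.boundary (Fin n), p.1 y = γ.extend 0 := fun y hy => by
    rw [p.2 y hy, Path.extend_zero]
  refine ⟨⟨Cube.collar 2 p.1 γ.extend, ?_⟩, fun y hy => ?_⟩
  · exact Cube.continuous_collar (κ := fun _ => 2) (p := fun _ => p.1) (c := fun _ => γ.extend)
      (y := id) continuous_const (by fun_prop) (by fun_prop) continuous_id (fun _ => hb)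
  · change Cube.collar 2 p.1 γ.extend y = x'
    rw [Cube.collar_of_mem_boundary one_le_two hy (hb y hy), show (2 - 1 : ℝ) = 1 by norm_num,
      Path.extend_one]

theorem GenLoop.transport_homotopic {n : ℕ} {X : Type*} [TopologicalSpace X] {x x' : X}
    (γ : Path x x') {p q : Ω^ (Fin n) X x} (h : GenLoop.Homotopic p q) :
    GenLoop.Homotopic (GenLoop.transport γ p) (GenLoop.transport γ q) := by
  obtain ⟨H⟩ := h
  have hb : ∀ (u : I), ∀ y ∈ Cube.boundary (Fin n), H (u, y) = γ.extend 0 := fun u y hy => by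
    rw [H.eq_fst u hy, Path.extend_zero]
    exact p.2 y hy
  refine ⟨⟨⟨⟨fun z => Cube.collar 2 (fun y => H (z.1, y)) γ.extend z.2, ?_⟩, ?_, ?_⟩, ?_⟩⟩
  · exact Cube.continuous_collar (κ := fun _ : I × (I^ (Fin n)) => 2)
      (p := fun z y => H (z.1, y)) (c := fun _ => γ.extend) continuous_const (by fun_prop)
      (by fun_prop) continuous_snd (fun z => hb z.1)
  · intro y
    change Cube.collar 2 (fun y => H (0, y)) γ.extend y = Cube.collar 2 p γ.extend y
    congr 1
    exact funext H.apply_zero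
  · intro y
    change Cube.collar 2 (fun y => H (1, y)) γ.extend y = Cube.collar 2 q γ.extend y
    congr 1
    exact funext H.apply_one
  · intro u y hy
    change Cube.collar 2 (fun y => H (u, y)) γ.extend y = GenLoop.transport γ p y
    rw [Cube.collar_of_mem_boundary one_le_two hy (hb u y hy), GenLoop.boundary (GenLoop.transport γ p) y hy]
    norm_num

/-- A free homotopy of generalized loops whose track on the boundary is `γ` exhibits its end as
the transport of its start along `γ`. -/
theorem GenLoop.transport_homotopic_of_track {n : ℕ} {X : Type*} [TopologicalSpace X] {x x' : X}
    (γ : Path x x') (p : Ω^ (Fin n) X x) (p' : Ω^ (Fin n) X x') (K : C(I × (I^ (Fin n)), X))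
    (h0 : ∀ y, K (0, y) = p y) (h1 : ∀ y, K (1, y) = p' y)
    (hb : ∀ (u : I), ∀ y ∈ Cube.boundary (Fin n), K (u, y) = γ u) :
    GenLoop.Homotopic (GenLoop.transport γ p) p' := by
  have hb' : ∀ (u : I), ∀ y ∈ Cube.boundary (Fin n), K (u, y) = γ.extend (u + 0) :=
    fun u y hy => by rw [hb u y hy, add_zero, Path.extend_apply γ u.2]
  -- At time `u` the inner cube carries `K (u, ·)` and the collar the remaining part of `γ`.
  refine ⟨⟨⟨⟨fun z => Cube.collar (2 - z.1) (fun y => K (z.1, y))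
    (fun v => γ.extend (z.1 + v)) z.2, ?_⟩, ?_, ?_⟩, ?_⟩⟩
  · exact Cube.continuous_collar (κ := fun z : I × (I^ (Fin n)) => 2 - (z.1 : ℝ))
      (p := fun z y => K (z.1, y)) (c := fun z v => γ.extend (z.1 + v)) (by fun_prop)
      (by fun_prop) (by fun_prop) continuous_snd (fun z => hb' z.1)
  · intro y
    change Cube.collar (2 - (0 : ℝ)) (fun y => K (0, y)) (fun v => γ.extend ((0 : ℝ) + v)) y =
      Cube.collar 2 p γ.extend y
    simp only [sub_zero, zero_add]
    congr 1
    exact funext h0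
  · intro y
    change Cube.collar (2 - (1 : ℝ)) (fun y => K (1, y)) (fun v => γ.extend ((1 : ℝ) + v)) y = p' y
    rw [show (2 - 1 : ℝ) = 1 by norm_num, Cube.collar_one, h1]
  · intro u y hy
    change Cube.collar (2 - (u : ℝ)) (fun y => K (u, y)) (fun v => γ.extend (u + v)) y =
      GenLoop.transport γ p y
    rw [Cube.collar_of_mem_boundary (by linarith [u.2.2]) hy (hb' u y hy),
      GenLoop.boundary (GenLoop.transport γ p) y hy, show (u : ℝ) + (2 - u - 1) = 1 by ring, Path.extend_one]

theorem GenLoop.transport_symm_transport {n : ℕ} {X : Type*} [TopologicalSpace X] {x x' : X}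
    (γ : Path x x') (p : Ω^ (Fin n) X x) :
    GenLoop.Homotopic (GenLoop.transport γ.symm (GenLoop.transport γ p)) p := by
  have hb : ∀ y ∈ Cube.boundary (Fin n), p y = γ.extend 0 := fun y hy => by
    rw [GenLoop.boundary p y hy, Path.extend_zero]
  refine GenLoop.transport_homotopic_of_track γ.symm (GenLoop.transport γ p) p
    ⟨fun z => Cube.collar (2 - z.1) p γ.extend z.2, ?_⟩ ?_ ?_ ?_
  · exact Cube.continuous_collar (κ := fun z : I × (I^ (Fin n)) => 2 - (z.1 : ℝ))
      (p := fun _ => p.1) (c := fun _ => γ.extend) (by fun_prop) (by fun_prop) (by fun_prop)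
      continuous_snd (fun _ => hb)
  · intro y
    change Cube.collar (2 - (0 : ℝ)) p γ.extend y = Cube.collar 2 p γ.extend y
    rw [sub_zero]
  · intro y
    change Cube.collar (2 - (1 : ℝ)) p γ.extend y = p y
    rw [show (2 - 1 : ℝ) = 1 by norm_num, Cube.collar_one]
  · intro u y hy
    change Cube.collar (2 - (u : ℝ)) p γ.extend y = γ (σ u)
    rw [Cube.collar_of_mem_boundary (by linarith [u.2.2]) hy (hb y hy),
      ← Path.extend_apply γ (σ u).2, unitInterval.coe_symm_eq]
    congr 1
    ring

/-! ### Homotopy equivalences are weak homotopy equivalences -/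

/-- A self-map homotopic to the identity acts on generalized loops as transport along the track of
the base point. -/
theorem GenLoop.transport_homotopic_pushforward {n : ℕ} {X : Type*} [TopologicalSpace X]
    {h : C(X, X)} (H : ContinuousMap.Homotopy (ContinuousMap.id X) h) (x : X)
    (p : Ω^ (Fin n) X x) :
    GenLoop.Homotopic (GenLoop.transport (H.evalAt x) p) (GenLoop.pushforward n h x p) := by
  refine GenLoop.transport_homotopic_of_track _ _ _
    ⟨fun z => H (z.1, p z.2), H.continuous.comp
      (continuous_fst.prodMk (p.1.continuous.comp continuous_snd))⟩ ?_ ?_ ?_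
  · intro y
    exact H.apply_zero (p y)
  · intro y
    exact H.apply_one (p y)
  · intro u y hy
    change H (u, p y) = H (u, x)
    rw [GenLoop.boundary p y hy]

theorem HomotopyGroup.bijective_inducedMap_of_homotopic_id {X : Type*} [TopologicalSpace X]
    {h : C(X, X)} (hh : h.Homotopic (ContinuousMap.id X)) (n : ℕ) (x : X) :
    Function.Bijective (HomotopyGroup.inducedMap n h x) := by
  obtain ⟨H⟩ := hh.symm
  constructor
  · rintro ⟨p⟩ ⟨q⟩ hpq
    have hpq' : GenLoop.Homotopic (GenLoop.pushforward n h x p) (GenLoop.pushforward n h x q) :=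
      Quotient.exact hpq
    have h1 := ((GenLoop.transport_homotopic_pushforward H x p).trans hpq').trans
      (GenLoop.transport_homotopic_pushforward H x q).symm
    exact Quotient.sound (((GenLoop.transport_symm_transport _ p).symm.trans
      (GenLoop.transport_homotopic (H.evalAt x).symm h1)).trans
      (GenLoop.transport_symm_transport _ q))
  · rintro ⟨q⟩
    refine ⟨Quotient.mk _ (GenLoop.transport (H.evalAt x).symm q), Quotient.sound ?_⟩
    refine (GenLoop.transport_homotopic_pushforward H x _).symm.trans ?_
    have h1 := GenLoop.transport_symm_transport (H.evalAt x).symm q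
    rwa [Path.symm_symm] at h1

theorem HomotopyGroup.inducedMap_comp {X Y Z : Type*} [TopologicalSpace X] [TopologicalSpace Y]
    [TopologicalSpace Z] (n : ℕ) (g : C(Y, Z)) (f : C(X, Y)) (x : X) :
    HomotopyGroup.inducedMap n (g.comp f) x =
      HomotopyGroup.inducedMap n g (f x) ∘ HomotopyGroup.inducedMap n f x := by
  funext p
  induction p using Quotient.inductionOn
  rfl

theorem ZerothHomotopy.bijective_inducedMap_of_homotopic_id {X : Type*} [TopologicalSpace X]
    {h : C(X, X)} (hh : h.Homotopic (ContinuousMap.id X)) :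
    Function.Bijective (ZerothHomotopy.inducedMap h) := by
  obtain ⟨H⟩ := hh
  have : ZerothHomotopy.inducedMap h = id := by
    funext x
    induction x using Quotient.inductionOn with
    | h x => exact Quotient.sound ⟨H.evalAt x⟩
  rw [this]
  exact Function.bijective_id

theorem ZerothHomotopy.inducedMap_comp {X Y Z : Type*} [TopologicalSpace X] [TopologicalSpace Y]
    [TopologicalSpace Z] (g : C(Y, Z)) (f : C(X, Y)) :
    ZerothHomotopy.inducedMap (g.comp f) =
      ZerothHomotopy.inducedMap g ∘ ZerothHomotopy.inducedMap f := by
  funext p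
  induction p using Quotient.inductionOn
  rfl

/-- If both composites in `A → B → C → D` are bijective, so is the first map. -/
theorem Function.bijective_of_bijective_comp {A B C D : Type*} {f : A → B} {g : B → C} {h : C → D}
    (hgf : Function.Bijective (g ∘ f)) (hhg : Function.Bijective (h ∘ g)) :
    Function.Bijective f := by
  have hg : Function.Bijective g := ⟨hhg.1.of_comp, hgf.2.of_comp⟩
  exact (Function.Bijective.of_comp_iff' hg f).1 hgf

theorem ContinuousMap.HomotopyEquiv.isWeakHomotopyEquiv {X Y : Type*} [TopologicalSpace X]
    [TopologicalSpace Y] (e : ContinuousMap.HomotopyEquiv X Y) : IsWeakHomotopyEquiv e.toFun := by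
  refine ⟨?_, fun n _ x => ?_⟩
  · refine Function.bijective_of_bijective_comp (g := ZerothHomotopy.inducedMap e.invFun)
      (h := ZerothHomotopy.inducedMap e.toFun) ?_ ?_
    · rw [← ZerothHomotopy.inducedMap_comp]
      exact ZerothHomotopy.bijective_inducedMap_of_homotopic_id e.left_inv
    · rw [← ZerothHomotopy.inducedMap_comp]
      exact ZerothHomotopy.bijective_inducedMap_of_homotopic_id e.right_inv
  · refine Function.bijective_of_bijective_comp
      (g := HomotopyGroup.inducedMap n e.invFun (e.toFun x))
      (h := HomotopyGroup.inducedMap n e.toFun (e.invFun (e.toFun x))) ?_ ?_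
    · rw [← HomotopyGroup.inducedMap_comp]
      exact HomotopyGroup.bijective_inducedMap_of_homotopic_id e.left_inv n x
    · rw [← HomotopyGroup.inducedMap_comp]
      exact HomotopyGroup.bijective_inducedMap_of_homotopic_id e.right_inv n (e.toFun x)

end Transport

/-! ### Maps into the one-point compactification -/

section OnePointCompactification

open Filter Topology OnePoint

theorem OnePoint.tendsto_nhds_infty_iff_norm {A E : Type*} [NormedAddCommGroup E] [ProperSpace E]
    {l : Filter A} {F : A → OnePoint E} :
    Tendsto F l (𝓝 ∞) ↔ ∀ M : ℝ, ∀ᶠ a in l, ∀ x : E, F a = x → M < ‖x‖ := by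
  rw [OnePoint.hasBasis_nhds_infty.tendsto_right_iff]
  constructor
  · intro h M
    filter_upwards [h (Metric.closedBall 0 M)
      ⟨Metric.isClosed_closedBall, isCompact_closedBall 0 M⟩] with a ha x hx
    rw [hx] at ha
    simpa using ha
  · rintro h s ⟨-, hs⟩
    obtain ⟨M, hM⟩ := hs.isBounded.exists_norm_le
    filter_upwards [h M] with a ha
    cases hF : F a using OnePoint.rec with
    | infty => exact Or.inr rfl
    | coe x => exact Or.inl ⟨x, fun hx => (ha x hF).not_ge (hM x hx), rfl⟩

/-- A quotient of a vector by a scalar, extended by `∞` to the points where the scalar is not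
positive, is continuous if the vector does not vanish together with the scalar. -/
theorem OnePoint.continuous_inv_smul {A E : Type*} [TopologicalSpace A] [NormedAddCommGroup E]
    [NormedSpace ℝ E] [ProperSpace E] {w : A → ℝ} {f : A → E} (hw : Continuous w)
    (hf : Continuous f) (h : ∀ a, w a = 0 → f a ≠ 0) :
    Continuous fun a => if 0 < w a then (((w a)⁻¹ • f a : E) : OnePoint E) else ∞ := by
  refine continuous_iff_continuousAt.2 fun a => ?_
  rcases lt_trichotomy (w a) 0 with ha | ha | ha
  · refine (continuousAt_const (y := (∞ : OnePoint E))).congr ?_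
    filter_upwards [hw.continuousAt.eventually_lt_const ha] with b hb
    rw [if_neg hb.not_gt]
  · have hfa : 0 < ‖f a‖ := norm_pos_iff.2 (h a ha)
    rw [ContinuousAt, ha, if_neg (lt_irrefl 0), OnePoint.tendsto_nhds_infty_iff_norm]
    intro M
    have hM : 0 < |M| + 1 := by positivity
    have h1 : w a * (|M| + 1) < ‖f a‖ := by rwa [ha, zero_mul]
    filter_upwards [(hw.mul_const (|M| + 1)).continuousAt.eventually_lt
      hf.norm.continuousAt h1] with b hb x hx
    split_ifs at hx with hb0
    · rw [← OnePoint.coe_injective hx, norm_smul, norm_inv, Real.norm_of_nonneg hb0.le,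
        lt_inv_mul_iff₀ hb0]
      exact (mul_le_mul_of_nonneg_left ((le_abs_self M).trans (by linarith)) hb0.le).trans_lt hb
    · exact absurd hx (OnePoint.infty_ne_coe x)
  · have h1 : ContinuousAt (fun b => (((w b)⁻¹ • f b : E) : OnePoint E)) a :=
      OnePoint.continuous_coe.continuousAt.comp
        ((hw.continuousAt.inv₀ ha.ne').smul hf.continuousAt)
    refine h1.congr ?_
    filter_upwards [hw.continuousAt.eventually_const_lt ha] with b hb
    rw [if_pos hb]

end OnePointCompactification

/-! ### The sup norm and radial stretching -/

section Stretch

open Topology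

/-- The sup norm on `ℝ^N`, for which the spatial part of a window is a closed ball. -/
noncomputable def supNorm {N : ℕ} (x : EuclideanSpace ℝ (Fin N)) : ℝ :=
  ‖fun i => x i‖

variable {N : ℕ}

@[fun_prop]
theorem continuous_supNorm : Continuous (supNorm (N := N)) := by
  unfold supNorm
  fun_prop

theorem supNorm_nonneg (x : EuclideanSpace ℝ (Fin N)) : 0 ≤ supNorm x :=
  norm_nonneg _

theorem supNorm_le_iff {x : EuclideanSpace ℝ (Fin N)} {r : ℝ} (hr : 0 ≤ r) :
    supNorm x ≤ r ↔ ∀ i, |x i| ≤ r :=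
  pi_norm_le_iff_of_nonneg hr

theorem supNorm_zero : supNorm (0 : EuclideanSpace ℝ (Fin N)) = 0 :=
  norm_zero (E := Fin N → ℝ)

theorem supNorm_eq_zero {x : EuclideanSpace ℝ (Fin N)} : supNorm x = 0 ↔ x = 0 := by
  refine ⟨fun h => ?_, fun h => by rw [h, supNorm_zero]⟩
  have h' := norm_eq_zero.1 h
  ext i
  exact congrFun h' i

theorem supNorm_smul (c : ℝ) (x : EuclideanSpace ℝ (Fin N)) :
    supNorm (c • x) = |c| * supNorm x :=
  norm_smul c (fun i => x i)

theorem isCompact_supNorm_le (r : ℝ) :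
    IsCompact {x : EuclideanSpace ℝ (Fin N) | supNorm x ≤ r} := by
  have h : {x : EuclideanSpace ℝ (Fin N) | supNorm x ≤ r} =
      (PiLp.homeomorph 2 fun _ : Fin N => ℝ) ⁻¹' Metric.closedBall 0 r := by
    ext x
    exact mem_closedBall_zero_iff.symm
  rw [h]
  exact (Homeomorph.isCompact_preimage _).2 (isCompact_closedBall 0 r)

theorem mem_window_iff {R : ℕ} {p : ℝ × EuclideanSpace ℝ (Fin N)} :
    p ∈ window N R ↔ |p.1| ≤ (R : ℝ) / 2 ∧ supNorm p.2 ≤ (R : ℝ) / 2 := by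
  rw [supNorm_le_iff (by positivity)]
  rfl

/-- The number by which `stretch` divides a vector of sup norm `r`. At time `τ = 1` it is `δ - r`,
except that it is not allowed to drop below `η * δ`. -/
noncomputable def stretchDivisor (η δ τ r : ℝ) : ℝ :=
  max (1 - τ + τ * (δ - r)) (η * δ)

/-- A radial map of `ℝ^N` to itself, the identity at time `τ = 0`. At time `τ = 1` it agrees with
the map `x ↦ x / (δ - ‖x‖)`, which blows up the ball of radius `δ` to the whole space, on all but a
thin shell of this ball; the cutoff `η` keeps it defined on the whole space. -/
noncomputable def stretch (η δ τ : ℝ) (x : EuclideanSpace ℝ (Fin N)) :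
    EuclideanSpace ℝ (Fin N) :=
  (stretchDivisor η δ τ (supNorm x))⁻¹ • x

variable {η δ τ : ℝ}

theorem stretchDivisor_pos (hη : 0 < η) (hδ : 0 < δ) (r : ℝ) : 0 < stretchDivisor η δ τ r :=
  lt_max_of_lt_right (mul_pos hη hδ)

theorem stretchDivisor_antitone (hτ : 0 ≤ τ) : Antitone (stretchDivisor η δ τ) := fun r s h =>
  max_le_max_right _ (by nlinarith)

theorem stretchDivisor_le_one (hη : η ≤ 1) (hδ : 0 < δ) (hδ1 : δ ≤ 1) (hτ : 0 ≤ τ) {r : ℝ}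
    (hr : 0 ≤ r) : stretchDivisor η δ τ r ≤ 1 :=
  max_le (by nlinarith) (by nlinarith)

theorem supNorm_stretch (hη : 0 < η) (hδ : 0 < δ) (x : EuclideanSpace ℝ (Fin N)) :
    supNorm (stretch η δ τ x) = supNorm x / stretchDivisor η δ τ (supNorm x) := by
  rw [stretch, supNorm_smul, abs_of_pos (inv_pos.2 (stretchDivisor_pos hη hδ _)), div_eq_inv_mul]

theorem supNorm_le_supNorm_stretch (hη : 0 < η) (hη1 : η ≤ 1) (hδ : 0 < δ) (hδ1 : δ ≤ 1)
    (hτ : 0 ≤ τ) (x : EuclideanSpace ℝ (Fin N)) : supNorm x ≤ supNorm (stretch η δ τ x) := by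
  rw [supNorm_stretch hη hδ, le_div_iff₀ (stretchDivisor_pos hη hδ _)]
  exact mul_le_of_le_one_right (supNorm_nonneg x)
    (stretchDivisor_le_one hη1 hδ hδ1 hτ (supNorm_nonneg x))

theorem stretch_injective (hη : 0 < η) (hδ : 0 < δ) (hτ : 0 ≤ τ) :
    Function.Injective (stretch (N := N) η δ τ) := by
  have key : ∀ x y : EuclideanSpace ℝ (Fin N), stretch η δ τ x = stretch η δ τ y →
      supNorm x ≤ supNorm y := by
    intro x y h
    by_contra! hlt
    have h' := congrArg supNorm h
    rw [supNorm_stretch hη hδ, supNorm_stretch hη hδ, div_eq_div_iff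
      (stretchDivisor_pos hη hδ _).ne' (stretchDivisor_pos hη hδ _).ne'] at h'
    have h1 := stretchDivisor_antitone (η := η) (δ := δ) hτ hlt.le
    have h2 := stretchDivisor_pos (τ := τ) hη hδ (supNorm y)
    nlinarith [supNorm_nonneg y]
  intro x y h
  have hxy : supNorm x = supNorm y := le_antisymm (key x y h) (key y x h.symm)
  rw [stretch, stretch, hxy] at h
  exact smul_right_injective _ (inv_pos.2 (stretchDivisor_pos hη hδ _)).ne' h

theorem continuous_stretch (hη : 0 < η) : Continuous
    fun q : (Set.Ioc (0 : ℝ) 1 × unitInterval) × EuclideanSpace ℝ (Fin N) =>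
      stretch η q.1.1 q.1.2 q.2 := by
  have h : Continuous fun q : (Set.Ioc (0 : ℝ) 1 × unitInterval) × EuclideanSpace ℝ (Fin N) =>
      stretchDivisor η q.1.1 q.1.2 (supNorm q.2) := by
    unfold stretchDivisor
    fun_prop
  exact (h.inv₀ fun q => (stretchDivisor_pos hη q.1.1.2.1 _).ne').smul continuous_snd

theorem stretch_zero (hη1 : η ≤ 1) (hδ : 0 < δ) (hδ1 : δ ≤ 1) (x : EuclideanSpace ℝ (Fin N)) :
    stretch η δ 0 x = x := by
  have h : stretchDivisor η δ 0 (supNorm x) = 1 := by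
    rw [stretchDivisor, sub_zero, zero_mul, add_zero]
    exact max_eq_left (by nlinarith)
  rw [stretch, h, inv_one, one_smul]

/-- The cutoff for `stretch` which is not visible in the window of size `R`. -/
noncomputable def windowCutoff (R : ℕ) : ℝ := ((R : ℝ) + 2)⁻¹

theorem windowCutoff_pos (R : ℕ) : 0 < windowCutoff R := by
  unfold windowCutoff
  positivity

theorem windowCutoff_le_one (R : ℕ) : windowCutoff R ≤ 1 :=
  inv_le_one_of_one_le₀ (by linarith [(Nat.cast_nonneg R : (0 : ℝ) ≤ R)])

theorem windowCutoff_antitone : Antitone windowCutoff := fun R S h => by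
  have h' : (R : ℝ) ≤ S := by exact_mod_cast h
  exact inv_anti₀ (by positivity) (by linarith)

/-- A vector for which the cutoff matters leaves the window when it is stretched: if `r / d` is at
most `R / 2`, for a divisor `d` not larger than that of `stretch`, then the cutoff is not active.
The case of general `d` covers both smaller cutoffs and no cutoff at all. -/
theorem windowCutoff_mul_le {R : ℕ} {r d : ℝ} (hδ : 0 < δ) (hδ1 : δ ≤ 1) (hτ1 : τ ≤ 1)
    (hr : 0 ≤ r) (hd : d ≤ stretchDivisor (windowCutoff R) δ τ r)
    (h : r ≤ (R : ℝ) / 2 * d) : windowCutoff R * δ ≤ 1 - τ + τ * (δ - r) := by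
  by_contra! hlt
  rw [stretchDivisor, max_eq_right hlt.le] at hd
  have hR : windowCutoff R * (R + 2) = 1 := inv_mul_cancel₀ (by positivity)
  have h1 : r ≤ (R : ℝ) / 2 * (windowCutoff R * δ) :=
    h.trans (mul_le_mul_of_nonneg_left hd (by positivity))
  have h2 : (R : ℝ) / 2 * (windowCutoff R * δ) = (1 / 2 - windowCutoff R) * δ := by
    linear_combination δ / 2 * hR
  nlinarith [mul_nonneg (sub_nonneg.2 hτ1) (sub_nonneg.2 hδ1), mul_nonneg (sub_nonneg.2 hτ1) hr]

theorem stretch_eq_of_le (x : EuclideanSpace ℝ (Fin N))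
    (h : η * δ ≤ 1 - τ + τ * (δ - supNorm x)) :
    stretch η δ τ x = (1 - τ + τ * (δ - supNorm x))⁻¹ • x := by
  rw [stretch, stretchDivisor, max_eq_left h]

theorem windowCutoff_mul_le_of_supNorm_stretch_le {R : ℕ} (hη : 0 < η) (hηR : η ≤ windowCutoff R)
    (hδ : 0 < δ) (hδ1 : δ ≤ 1) (hτ1 : τ ≤ 1) {x : EuclideanSpace ℝ (Fin N)}
    (h : supNorm (stretch η δ τ x) ≤ (R : ℝ) / 2) :
    windowCutoff R * δ ≤ 1 - τ + τ * (δ - supNorm x) := by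
  refine windowCutoff_mul_le (d := stretchDivisor η δ τ (supNorm x)) hδ hδ1 hτ1
    (supNorm_nonneg x) (max_le_max_left _ (mul_le_mul_of_nonneg_right hηR hδ.le)) ?_
  rwa [supNorm_stretch hη hδ, div_le_iff₀ (stretchDivisor_pos hη hδ _)] at h

end Stretch

/-! ### Maps of unordered configuration spaces -/

section ConfigurationMaps

theorem Conf.continuous_apply {n : ℕ} {X : Type} [TopologicalSpace X] (i : Fin n) :
    Continuous fun x : Conf n X => x.1 i :=
  (_root_.continuous_apply i).comp continuous_subtype_val

/-- The unordered configuration underlying an ordered one. -/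
def UConf.mk {n : ℕ} {X : Type} (x : Conf n X) : UConf n X := Quotient.mk (Conf.permSetoid n X) x

theorem UConf.isOpenQuotientMap_mk (n : ℕ) (X : Type) [TopologicalSpace X] :
    IsOpenQuotientMap (UConf.mk : Conf n X → UConf n X) := by
  refine ⟨Quotient.mk_surjective, continuous_quotient_mk', fun U hU => ?_⟩
  -- The saturation of `U` is the union of its translates under the symmetric group.
  have h : (UConf.mk : Conf n X → UConf n X) ⁻¹' (UConf.mk '' U) =
      ⋃ σ : Equiv.Perm (Fin n),
        (fun x : Conf n X => (⟨x.1 ∘ σ, x.2.comp σ.injective⟩ : Conf n X)) ⁻¹' U := by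
    ext x
    simp only [Set.mem_preimage, Set.mem_image, Set.mem_iUnion]
    constructor
    · rintro ⟨y, hy, hyx⟩
      obtain ⟨σ, hσ⟩ := (Conf.permSetoid n X).symm (Quotient.exact hyx)
      refine ⟨σ, ?_⟩
      convert hy using 1
      exact Subtype.ext (funext fun i => (hσ i).symm)
    · rintro ⟨σ, hσ⟩
      exact ⟨_, hσ, Quotient.sound ((Conf.permSetoid n X).symm ⟨σ, fun _ => rfl⟩)⟩
  have h' : IsOpen ((UConf.mk : Conf n X → UConf n X) ⁻¹' (UConf.mk '' U)) := by
    rw [h]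
    refine isOpen_iUnion fun σ => hU.preimage ?_
    exact Continuous.subtype_mk (continuous_pi fun i => Conf.continuous_apply (σ i)) _
  exact isOpen_coinduced.2 h'

variable {n : ℕ} {X Y : Type}

/-- The map of unordered configuration spaces induced by an injective map. -/
def UConf.map (f : X → Y) (hf : Function.Injective f) : UConf n X → UConf n Y :=
  Quotient.map' (s₁ := Conf.permSetoid n X) (s₂ := Conf.permSetoid n Y)
    (fun x => ⟨f ∘ x.1, hf.comp x.2⟩)
    (fun _ _ ⟨σ, h⟩ => ⟨σ, fun i => congrArg f (h i)⟩)

theorem UConf.points_map (f : X → Y) (hf : Function.Injective f) (c : UConf n X) :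
    (c.map f hf).points = f '' c.points := by
  induction c using Quotient.inductionOn with
  | h x => exact Set.range_comp f x.1

theorem UConf.map_eq_self {f : X → X} (hf : Function.Injective f) (h : ∀ x, f x = x)
    (c : UConf n X) : c.map f hf = c := by
  induction c using Quotient.inductionOn with
  | h x => exact congrArg (Quotient.mk _) (Subtype.ext (funext fun i => h (x.1 i)))

theorem UConf.continuous_map [TopologicalSpace X] [TopologicalSpace Y] {A : Type*}
    [TopologicalSpace A] {f : A → X → Y} (hf : ∀ a, Function.Injective (f a))
    (hc : Continuous fun q : A × X => f q.1 q.2) :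
    Continuous fun q : A × UConf n X => q.2.map (f q.1) (hf q.1) := by
  rw [← (IsOpenQuotientMap.id.prodMap (UConf.isOpenQuotientMap_mk n X)).continuous_comp_iff]
  refine (UConf.isOpenQuotientMap_mk n Y).continuous.comp
    (f := fun q : A × Conf n X => (⟨f q.1 ∘ q.2.1, (hf q.1).comp q.2.2⟩ : Conf n Y)) ?_
  refine Continuous.subtype_mk (continuous_pi fun i => ?_) _
  exact hc.comp (f := fun q : A × Conf n X => (q.1, q.2.1 i))
    (continuous_fst.prodMk ((Conf.continuous_apply i).comp continuous_snd))

end ConfigurationMaps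

/-! ### The separation of a configuration at the origin -/

section Separation

variable {N n : ℕ}

/-- The largest number `δ ≤ 1` such that `S` has at most one point of sup norm less than `δ`. -/
noncomputable def separation (S : Set (EuclideanSpace ℝ (Fin N))) : ℝ :=
  sInf ({1} ∪ {r | ∃ x ∈ S, ∃ y ∈ S, x ≠ y ∧ r = max (supNorm x) (supNorm y)})

theorem le_separation_iff {S : Set (EuclideanSpace ℝ (Fin N))} {a : ℝ} :
    a ≤ separation S ↔ a ≤ 1 ∧ ∀ x ∈ S, ∀ y ∈ S, x ≠ y → a ≤ max (supNorm x) (supNorm y) := by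
  have hb : BddBelow ({1} ∪ {r | ∃ x ∈ S, ∃ y ∈ S, x ≠ y ∧ r = max (supNorm x) (supNorm y)}) := by
    refine ⟨0, ?_⟩
    rintro r (rfl | ⟨x, -, y, -, -, rfl⟩)
    · exact zero_le_one
    · exact le_max_of_le_left (supNorm_nonneg x)
  rw [separation, le_csInf_iff hb ⟨1, Or.inl rfl⟩]
  constructor
  · intro h
    exact ⟨h 1 (Or.inl rfl), fun x hx y hy hxy => h _ (Or.inr ⟨x, hx, y, hy, hxy, rfl⟩)⟩
  · rintro ⟨h1, h2⟩ r (rfl | ⟨x, hx, y, hy, hxy, rfl⟩)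
    · exact h1
    · exact h2 x hx y hy hxy

theorem separation_le_one (S : Set (EuclideanSpace ℝ (Fin N))) : separation S ≤ 1 :=
  (le_separation_iff.1 le_rfl).1

theorem separation_of_subsingleton {S : Set (EuclideanSpace ℝ (Fin N))} (hS : S.Subsingleton) :
    separation S = 1 :=
  le_antisymm (separation_le_one S)
    (le_separation_iff.2 ⟨le_rfl, fun _ hx _ hy hxy => absurd (hS hx hy) hxy⟩)

theorem eq_of_supNorm_lt_separation {S : Set (EuclideanSpace ℝ (Fin N))}
    {x y : EuclideanSpace ℝ (Fin N)} (hx : x ∈ S) (hy : y ∈ S) (hxS : supNorm x < separation S)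
    (hyS : supNorm y < separation S) : x = y := by
  by_contra hxy
  exact (max_lt hxS hyS).not_ge ((le_separation_iff.1 le_rfl).2 x hx y hy hxy)

/-- The separation only depends on the points in the unit ball. -/
theorem separation_congr {S T : Set (EuclideanSpace ℝ (Fin N))}
    (h : ∀ x, supNorm x ≤ 1 → (x ∈ S ↔ x ∈ T)) : separation S = separation T := by
  have key : ∀ {S T : Set (EuclideanSpace ℝ (Fin N))},
      (∀ x, supNorm x ≤ 1 → (x ∈ S ↔ x ∈ T)) → separation S ≤ separation T := by
    intro S T h
    refine le_separation_iff.2 ⟨separation_le_one S, fun x hx y hy hxy => ?_⟩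
    rcases le_total (supNorm x) 1 with hx1 | hx1
    · rcases le_total (supNorm y) 1 with hy1 | hy1
      · exact (le_separation_iff.1 le_rfl).2 x ((h x hx1).2 hx) y ((h y hy1).2 hy) hxy
      · exact (separation_le_one S).trans (le_max_of_le_right hy1)
    · exact (separation_le_one S).trans (le_max_of_le_left hx1)
  exact le_antisymm (key h) (key fun x hx => (h x hx).symm)

/-- The value at `i` of the finite family whose minimum is the separation of `x`. -/
noncomputable def Conf.pairNorm (x : Conf n (EuclideanSpace ℝ (Fin N))) :
    Option {p : Fin n × Fin n // p.1 ≠ p.2} → ℝ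
  | none => 1
  | some p => max (supNorm (x.1 p.1.1)) (supNorm (x.1 p.1.2))

theorem Conf.separation_range (x : Conf n (EuclideanSpace ℝ (Fin N))) :
    separation (Set.range x.1) = Finset.univ.inf' Finset.univ_nonempty x.pairNorm := by
  refine eq_of_forall_le_iff fun a => ?_
  rw [le_separation_iff, Finset.le_inf'_iff]
  constructor
  · rintro ⟨h1, h2⟩ (_ | ⟨⟨i, j⟩, hij⟩) -
    · exact h1
    · exact h2 _ ⟨i, rfl⟩ _ ⟨j, rfl⟩ fun h => hij (x.2 h)
  · refine fun h => ⟨h none (Finset.mem_univ _), ?_⟩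
    rintro _ ⟨i, rfl⟩ _ ⟨j, rfl⟩ hij
    exact h (some ⟨(i, j), fun h => hij (congrArg x.1 h)⟩) (Finset.mem_univ _)

theorem UConf.separation_pos (c : UConf n (EuclideanSpace ℝ (Fin N))) :
    0 < separation c.points := by
  induction c using Quotient.inductionOn with
  | h x =>
    change 0 < separation (Set.range x.1)
    rw [Conf.separation_range, Finset.lt_inf'_iff]
    rintro (_ | ⟨⟨i, j⟩, hij⟩) -
    · exact zero_lt_one
    · by_contra! h
      obtain ⟨hi, hj⟩ := max_le_iff.1 h
      exact hij (x.2 ((supNorm_eq_zero.1 (hi.antisymm (supNorm_nonneg _))).trans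
        (supNorm_eq_zero.1 (hj.antisymm (supNorm_nonneg _))).symm))

theorem Conf.continuous_separation_range :
    Continuous fun x : Conf n (EuclideanSpace ℝ (Fin N)) => separation (Set.range x.1) := by
  simp only [Conf.separation_range]
  refine Continuous.finset_inf'_apply _ ?_
  rintro (_ | p) -
  · exact continuous_const
  · exact (continuous_supNorm.comp (Conf.continuous_apply p.1.1)).max
      (continuous_supNorm.comp (Conf.continuous_apply p.1.2))

/-- The separation of an unordered configuration, as a number in `(0, 1]`. -/
noncomputable def UConf.separation (c : UConf n (EuclideanSpace ℝ (Fin N))) :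
    Set.Ioc (0 : ℝ) 1 :=
  ⟨_root_.separation c.points, c.separation_pos, separation_le_one _⟩

@[fun_prop]
theorem UConf.continuous_separation :
    Continuous (UConf.separation : UConf n (EuclideanSpace ℝ (Fin N)) → Set.Ioc (0 : ℝ) 1) := by
  refine Continuous.subtype_mk ?_ _
  rw [← (UConf.isOpenQuotientMap_mk n _).continuous_comp_iff]
  exact Conf.continuous_separation_range

end Separation

/-! ### The isolated point of a configuration -/

section IsolatedPoint

open Topology OnePoint

variable {N n : ℕ}

/-- The blow-up of the open ball of radius `δ` to the whole space, which sends everything outside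
of this ball to the point at infinity. -/
noncomputable def blowUp (δ : ℝ) (x : EuclideanSpace ℝ (Fin N)) :
    OnePoint (EuclideanSpace ℝ (Fin N)) :=
  if 0 < δ - supNorm x then ((δ - supNorm x)⁻¹ • x : EuclideanSpace ℝ (Fin N)) else ∞

theorem continuous_blowUp : Continuous
    fun q : Set.Ioc (0 : ℝ) 1 × EuclideanSpace ℝ (Fin N) => blowUp (q.1 : ℝ) q.2 := by
  refine OnePoint.continuous_inv_smul (w := fun q : Set.Ioc (0 : ℝ) 1 ×
    EuclideanSpace ℝ (Fin N) => (q.1 : ℝ) - supNorm q.2) (by fun_prop) continuous_snd ?_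
  rintro ⟨⟨δ, hδ⟩, x⟩ h rfl
  rw [supNorm_zero, sub_zero] at h
  exact hδ.1.ne' h

open Classical in
/-- The blow-up of the only point of `S` whose sup norm is less than the separation of `S`, and
the point at infinity if there is no such point. -/
noncomputable def isolatedPoint (S : Set (EuclideanSpace ℝ (Fin N))) :
    OnePoint (EuclideanSpace ℝ (Fin N)) :=
  if h : ∃ x ∈ S, supNorm x < separation S then blowUp (separation S) h.choose else ∞

theorem isolatedPoint_eq_blowUp {S : Set (EuclideanSpace ℝ (Fin N))}
    {x : EuclideanSpace ℝ (Fin N)} (hx : x ∈ S) (hxS : supNorm x < separation S) :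
    isolatedPoint S = blowUp (separation S) x := by
  have h : ∃ x ∈ S, supNorm x < separation S := ⟨x, hx, hxS⟩
  rw [isolatedPoint, dif_pos h,
    eq_of_supNorm_lt_separation h.choose_spec.1 hx h.choose_spec.2 hxS]

theorem isolatedPoint_eq_infty {S : Set (EuclideanSpace ℝ (Fin N))}
    (h : ∀ x ∈ S, separation S ≤ supNorm x) : isolatedPoint S = ∞ :=
  dif_neg fun ⟨x, hx, hxS⟩ => hxS.not_ge (h x hx)

theorem isolatedPoint_eq_coe_iff {S : Set (EuclideanSpace ℝ (Fin N))}
    {y : EuclideanSpace ℝ (Fin N)} : isolatedPoint S = y ↔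
      ∃ x ∈ S, 0 < separation S - supNorm x ∧ (separation S - supNorm x)⁻¹ • x = y := by
  by_cases h : ∃ x ∈ S, supNorm x < separation S
  · obtain ⟨x, hx, hxS⟩ := h
    rw [isolatedPoint_eq_blowUp hx hxS, blowUp, if_pos (sub_pos.2 hxS), OnePoint.coe_eq_coe]
    refine ⟨fun h => ⟨x, hx, sub_pos.2 hxS, h⟩, ?_⟩
    rintro ⟨z, hz, hzS, rfl⟩
    rw [eq_of_supNorm_lt_separation hx hz hxS (sub_pos.1 hzS)]
  · push Not at h
    rw [isolatedPoint_eq_infty h]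
    refine ⟨fun h => absurd h (OnePoint.infty_ne_coe y), ?_⟩
    rintro ⟨x, hx, hxS, -⟩
    exact absurd (h x hx) (not_le.2 (sub_pos.1 hxS))

theorem isolatedPoint_congr {S T : Set (EuclideanSpace ℝ (Fin N))}
    (h : ∀ x, supNorm x ≤ 1 → (x ∈ S ↔ x ∈ T)) : isolatedPoint S = isolatedPoint T := by
  have hsep := separation_congr h
  by_cases hS : ∃ x ∈ S, supNorm x < separation S
  · obtain ⟨x, hx, hxS⟩ := hS
    rw [isolatedPoint_eq_blowUp hx hxS, isolatedPoint_eq_blowUp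
      ((h x (hxS.le.trans (separation_le_one S))).1 hx) (hsep ▸ hxS), hsep]
  · push Not at hS
    rw [isolatedPoint_eq_infty hS, isolatedPoint_eq_infty]
    intro x hx
    rcases le_total (supNorm x) 1 with hx1 | hx1
    · exact hsep ▸ hS x ((h x hx1).2 hx)
    · exact (separation_le_one T).trans hx1

/-- In a vector space which contains the one-point compactification, the isolated point can be
computed as a sum over all points, at most one of whose terms is not zero. -/
theorem Conf.apply_isolatedPoint_range {V : Type*} [AddCommGroup V]
    (e : OnePoint (EuclideanSpace ℝ (Fin N)) → V) (x : Conf n (EuclideanSpace ℝ (Fin N))) :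
    e (isolatedPoint (Set.range x.1)) =
      e ∞ + ∑ i, (e (blowUp (separation (Set.range x.1)) (x.1 i)) - e ∞) := by
  have h0 : ∀ i, ¬ supNorm (x.1 i) < separation (Set.range x.1) →
      e (blowUp (separation (Set.range x.1)) (x.1 i)) - e ∞ = 0 := fun i hi => by
    rw [blowUp, if_neg (mt sub_pos.1 hi), sub_self]
  by_cases h : ∃ i, supNorm (x.1 i) < separation (Set.range x.1)
  · obtain ⟨i, hi⟩ := h
    rw [isolatedPoint_eq_blowUp (Set.mem_range_self i) hi, Finset.sum_eq_single i]
    · abel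
    · intro j _ hji
      exact h0 j fun hj => hji (x.2 (eq_of_supNorm_lt_separation (Set.mem_range_self j)
        (Set.mem_range_self i) hj hi))
    · exact fun h => absurd (Finset.mem_univ i) h
  · push Not at h
    rw [isolatedPoint_eq_infty (by rintro _ ⟨i, rfl⟩; exact h i),
      Finset.sum_eq_zero fun i _ => h0 i (h i).not_gt, add_zero]

theorem UConf.continuous_isolatedPoint : Continuous
    fun c : UConf n (EuclideanSpace ℝ (Fin N)) => isolatedPoint c.points := by
  rw [← (UConf.isOpenQuotientMap_mk n _).continuous_comp_iff]
  change Continuous fun x : Conf n (EuclideanSpace ℝ (Fin N)) => isolatedPoint (Set.range x.1)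
  have he := Topology.IsEmbedding.subtypeVal.comp
    (onePointEquivSphereOfFinrankEq (ι := Fin (N + 1)) (V := EuclideanSpace ℝ (Fin N))
      (by simp)).isEmbedding
  rw [he.isInducing.continuous_iff]
  simp only [Function.comp_def, Conf.apply_isolatedPoint_range fun p =>
    (onePointEquivSphereOfFinrankEq (ι := Fin (N + 1)) (V := EuclideanSpace ℝ (Fin N))
      (by simp) p : EuclideanSpace ℝ (Fin (N + 1)))]
  refine continuous_const.add (continuous_finsetSum _ fun i _ =>
    (he.continuous.comp (continuous_blowUp.comp (f := fun x : Conf n (EuclideanSpace ℝ (Fin N)) =>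
      (UConf.separation (UConf.mk x), x.1 i)) ?_)).sub continuous_const)
  exact (UConf.continuous_separation.comp (UConf.isOpenQuotientMap_mk n _).continuous).prodMk
    (Conf.continuous_apply i)

end IsolatedPoint

/-! ### Stretching paths of configurations -/

section StretchPath

open Topology unitInterval

variable {N n : ℕ}

theorem ConfPath.mem_image {X : Type} [TopologicalSpace X] {φ : ConfPath n X} {p : ℝ × X} :
    p ∈ φ.image ↔ p.2 ∈ (φ.1 p.1).2.points := by
  constructor
  · rintro ⟨t, ht, hp⟩
    rw [φ.2 t] at ht
    rwa [ht]
  · exact fun h => ⟨p.1, (φ.2 p.1).symm, h⟩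

/-- The points of a path in the spatial ball of sup norm `R / 2` at a time in `[-R/2, R/2]` are
determined by what is seen inside the window. -/
theorem ConfPath.mem_points_iff_of_sameOn {R : ℕ}
    {φ ψ : Σ n : ℕ, ConfPath n (EuclideanSpace ℝ (Fin N))}
    (h : φ.2.image ∩ window N R = ψ.2.image ∩ window N R) {t : ℝ} (ht : |t| ≤ (R : ℝ) / 2)
    {x : EuclideanSpace ℝ (Fin N)} (hx : supNorm x ≤ (R : ℝ) / 2) :
    x ∈ (φ.2.1 t).2.points ↔ x ∈ (ψ.2.1 t).2.points := by
  have h' := Set.ext_iff.1 h (t, x)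
  have hw : (t, x) ∈ window N R := mem_window_iff.2 ⟨ht, hx⟩
  rw [Set.mem_inter_iff, Set.mem_inter_iff, and_iff_left hw, and_iff_left hw,
    ConfPath.mem_image, ConfPath.mem_image] at h'
  exact h'

/-- At time `τ`, the path of configurations is slowed down by the factor `1 - τ` and stretched
in space, where `δ` is the separation of its configuration at time `0`. -/
noncomputable def ConfPath.stretch {η : ℝ} (hη : 0 < η) (τ : I)
    (φ : ConfPath n (EuclideanSpace ℝ (Fin N))) : ConfPath n (EuclideanSpace ℝ (Fin N)) :=
  ⟨⟨fun t => (t, (φ.1 ((1 - τ) * t)).2.map (_root_.stretch η (φ.1 0).2.separation τ)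
      (stretch_injective hη (φ.1 0).2.separation.2.1 τ.2.1)),
    continuous_id.prodMk ((UConf.continuous_map
      (f := fun a : Set.Ioc (0 : ℝ) 1 × I => _root_.stretch (N := N) η a.1 a.2)
      (fun a => stretch_injective hη a.1.2.1 a.2.2.1) (continuous_stretch hη)).comp
      (f := fun t : ℝ => (((φ.1 0).2.separation, τ), (φ.1 ((1 - τ) * t)).2)) (by fun_prop))⟩,
    fun _ => rfl⟩

theorem ConfPath.continuous_stretch {η : ℝ} (hη : 0 < η) : Continuous
    fun q : I × ConfPath n (EuclideanSpace ℝ (Fin N)) => ConfPath.stretch hη q.1 q.2 := by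
  refine Continuous.subtype_mk (ContinuousMap.continuous_of_continuous_uncurry _ ?_) _
  refine continuous_snd.prodMk ((UConf.continuous_map
      (f := fun a : Set.Ioc (0 : ℝ) 1 × I => _root_.stretch (N := N) η a.1 a.2)
      (fun a => stretch_injective hη a.1.2.1 a.2.2.1) (_root_.continuous_stretch hη)).comp
      (f := fun q : (I × ConfPath n (EuclideanSpace ℝ (Fin N))) × ℝ =>
        (((q.1.2.1 0).2.separation, q.1.1), (q.1.2.1 ((1 - q.1.1) * q.2)).2)) ?_)
  have h : Continuous fun q : (I × ConfPath n (EuclideanSpace ℝ (Fin N))) × ℝ =>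
      q.1.2.1 ((1 - q.1.1) * q.2) :=
    (continuous_subtype_val.comp (continuous_snd.comp continuous_fst)).eval (by fun_prop)
  have h0 : Continuous fun q : (I × ConfPath n (EuclideanSpace ℝ (Fin N))) × ℝ => q.1.2.1 0 :=
    (continuous_subtype_val.comp (continuous_snd.comp continuous_fst)).eval continuous_const
  fun_prop

theorem ConfPath.mem_image_stretch {η : ℝ} (hη : 0 < η) (τ : I)
    (φ : ConfPath n (EuclideanSpace ℝ (Fin N))) {p : ℝ × EuclideanSpace ℝ (Fin N)} :
    p ∈ (φ.stretch hη τ).image ↔ ∃ x ∈ (φ.1 ((1 - τ) * p.1)).2.points,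
      _root_.stretch η (_root_.separation (φ.1 0).2.points) τ x = p.2 := by
  rw [ConfPath.mem_image]
  exact Set.ext_iff.1 (UConf.points_map _ (stretch_injective hη (φ.1 0).2.separation.2.1 τ.2.1)
    (φ.1 ((1 - τ) * p.1)).2) p.2

theorem ConfPath.stretch_zero {η : ℝ} (hη : 0 < η) (hη1 : η ≤ 1)
    (φ : ConfPath n (EuclideanSpace ℝ (Fin N))) : φ.stretch hη 0 = φ := by
  refine Subtype.ext (ContinuousMap.ext fun t => Prod.ext (φ.2 t).symm ?_)
  have h : (1 - ((0 : I) : ℝ)) * t = t := by rw [Set.Icc.coe_zero, sub_zero, one_mul]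
  refine (UConf.map_eq_self (stretch_injective hη (φ.1 0).2.separation.2.1 le_rfl)
    (_root_.stretch_zero hη1 (φ.1 0).2.separation.2.1 (φ.1 0).2.separation.2.2) _).trans ?_
  rw [h]

theorem one_le_cast_add_two_div_two (R : ℕ) : (1 : ℝ) ≤ ((R + 2 : ℕ) : ℝ) / 2 := by
  push_cast
  linarith [(Nat.cast_nonneg R : (0 : ℝ) ≤ R)]

/-- What is seen inside a window after stretching depends only on what was seen before inside the
window whose size is larger by `2`. The larger window contains the unit ball at time `0`, which
determines the separation. -/
theorem ConfPath.stretch_sameOn {R : ℕ} {η : ℝ} (hη : 0 < η) (hη1 : η ≤ 1) (τ : I)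
    {φ ψ : Σ n : ℕ, ConfPath n (EuclideanSpace ℝ (Fin N))}
    (h : φ.2.image ∩ window N (R + 2) = ψ.2.image ∩ window N (R + 2)) :
    (φ.2.stretch hη τ).image ∩ window N R = (ψ.2.stretch hη τ).image ∩ window N R := by
  have hR := one_le_cast_add_two_div_two R
  have hR' : (R : ℝ) / 2 ≤ ((R + 2 : ℕ) : ℝ) / 2 := by push_cast; linarith
  have hsep : _root_.separation (φ.2.1 0).2.points = _root_.separation (ψ.2.1 0).2.points :=
    separation_congr fun x hx => ConfPath.mem_points_iff_of_sameOn h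
      (by rw [abs_zero]; exact zero_le_one.trans hR) (hx.trans hR)
  ext p
  refine and_congr_left fun hp => ?_
  rw [ConfPath.mem_image_stretch, ConfPath.mem_image_stretch, hsep]
  obtain ⟨hp1, hp2⟩ := mem_window_iff.1 hp
  refine exists_congr fun x => and_congr_left fun hx => ?_
  refine ConfPath.mem_points_iff_of_sameOn h ?_ ?_
  · rw [abs_mul, abs_of_nonneg (sub_nonneg.2 τ.2.2)]
    exact (mul_le_of_le_one_left (abs_nonneg _) (sub_le_self 1 τ.2.1)).trans (hp1.trans hR')
  · refine le_trans ?_ (hp2.trans hR')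
    rw [← hx]
    exact supNorm_le_supNorm_stretch hη hη1 (ψ.2.1 0).2.separation_pos
      (separation_le_one _) τ.2.1 x

/-- The choice of the cutoff is not visible in the window. -/
theorem ConfPath.stretch_sameOn_cutoff {R : ℕ} {η η' : ℝ} (hη : 0 < η) (hη' : 0 < η')
    (hηR : η ≤ windowCutoff R) (hηR' : η' ≤ windowCutoff R) (τ : I)
    (φ : ConfPath n (EuclideanSpace ℝ (Fin N))) :
    (φ.stretch hη τ).image ∩ window N R = (φ.stretch hη' τ).image ∩ window N R := by
  have key : ∀ {η η' : ℝ} (hη : 0 < η) (hη' : 0 < η'), η ≤ windowCutoff R →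
      η' ≤ windowCutoff R →
      (φ.stretch hη τ).image ∩ window N R ⊆ (φ.stretch hη' τ).image ∩ window N R := by
    rintro η η' hη hη' hηR hηR' p ⟨hp, hpw⟩
    refine ⟨?_, hpw⟩
    rw [ConfPath.mem_image_stretch] at hp ⊢
    obtain ⟨x, hx, hxp⟩ := hp
    refine ⟨x, hx, ?_⟩
    have hδ := (φ.1 0).2.separation_pos
    have h := windowCutoff_mul_le_of_supNorm_stretch_le hη hηR hδ (separation_le_one _) τ.2.2
      (hxp ▸ (mem_window_iff.1 hpw).2)
    rw [← hxp, stretch_eq_of_le x ((mul_le_mul_of_nonneg_right hηR hδ.le).trans h),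
      stretch_eq_of_le x ((mul_le_mul_of_nonneg_right hηR' hδ.le).trans h)]
  exact (key hη hη' hηR hηR').antisymm (key hη' hη hηR' hηR)

end StretchPath

/-! ### The stretching homotopy on local images -/

section Maps

open Topology unitInterval OnePoint

variable {N : ℕ}

/-- A map on the product with a disjoint union is continuous if it is so on each summand. -/
theorem continuous_prod_sigma {B ι Z : Type*} {Y : ι → Type*} [TopologicalSpace B]
    [∀ i, TopologicalSpace (Y i)] [TopologicalSpace Z] {G : B × (Σ i, Y i) → Z}
    (h : ∀ i, Continuous fun q : B × Y i => G (q.1, ⟨i, q.2⟩)) : Continuous G := by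
  have h' : Continuous fun q : (Σ i, Y i) × B => G (q.2, q.1) :=
    (Homeomorph.sigmaProdDistrib (X := Y) (Y := B)).symm.comp_continuous_iff'.1
      (continuous_sigma fun i => (h i).comp continuous_swap)
  exact h'.comp continuous_swap

/-- What is seen of a path inside `P`. -/
def PathGerm.mk {X : Type} [TopologicalSpace X] (P : Set (ℝ × X)) (φ : Σ n : ℕ, ConfPath n X) :
    PathGerm P :=
  Quotient.mk (ConfPath.sameOn P) φ

theorem PathGerm.isQuotientMap_mk {X : Type} [TopologicalSpace X] (P : Set (ℝ × X)) :
    IsQuotientMap (PathGerm.mk P) :=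
  isQuotientMap_quotient_mk'

theorem PathGerm.mk_eq_mk {X : Type} [TopologicalSpace X] {P : Set (ℝ × X)}
    {φ ψ : Σ n : ℕ, ConfPath n X} :
    PathGerm.mk P φ = PathGerm.mk P ψ ↔ φ.2.image ∩ P = ψ.2.image ∩ P :=
  Quotient.eq (r := ConfPath.sameOn P)

/-- Up to any given stage, a local image is seen by a single path. -/
theorem LocalImages.exists_rep (φ : LocalImages N) (S : ℕ) :
    ∃ ψ : Σ n : ℕ, ConfPath n (EuclideanSpace ℝ (Fin N)),
      ∀ R ≤ S, φ.1 R = PathGerm.mk (window N R) ψ := by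
  obtain ⟨ψ, hψ⟩ := (PathGerm.isQuotientMap_mk (window N S)).surjective (φ.1 S)
  refine ⟨ψ, fun R hR => ?_⟩
  rw [← φ.2 R S hR, ← hψ]
  rfl

/-- The effect of `ConfPath.stretch` on what is seen inside a window. -/
noncomputable def PathGerm.stretch (N R : ℕ) (q : I × PathGerm (window N (R + 2))) :
    PathGerm (window N R) :=
  Quotient.map' (s₁ := ConfPath.sameOn (window N (R + 2))) (s₂ := ConfPath.sameOn (window N R))
    (fun φ => ⟨φ.1, φ.2.stretch (windowCutoff_pos R) q.1⟩)
    (fun _ _ h => ConfPath.stretch_sameOn (windowCutoff_pos R) (windowCutoff_le_one R) q.1 h) q.2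

theorem PathGerm.continuous_stretch (N R : ℕ) : Continuous (PathGerm.stretch N R) := by
  refine (PathGerm.isQuotientMap_mk _).continuous_lift_prod_right ?_
  exact continuous_prod_sigma (G := fun q : I × Σ n : ℕ, ConfPath n (EuclideanSpace ℝ (Fin N)) =>
    PathGerm.stretch N R (q.1, PathGerm.mk _ q.2)) fun n =>
      ((PathGerm.isQuotientMap_mk (window N R)).continuous.comp continuous_sigmaMk).comp
        (ConfPath.continuous_stretch (windowCutoff_pos R))

/-- The homotopy which slows down and stretches local images. -/
noncomputable def LocalImages.stretch (N : ℕ) (q : I × LocalImages N) : LocalImages N := by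
  refine ⟨fun R => PathGerm.stretch N R (q.1, q.2.1 (R + 2)), fun R S h => ?_⟩
  obtain ⟨ψ, hψ⟩ := q.2.exists_rep (S + 2)
  change PathGerm.restrict _ (PathGerm.stretch N S (q.1, q.2.1 (S + 2))) =
    PathGerm.stretch N R (q.1, q.2.1 (R + 2))
  rw [hψ (S + 2) le_rfl, hψ (R + 2) (by omega)]
  exact PathGerm.mk_eq_mk.2 (ConfPath.stretch_sameOn_cutoff (windowCutoff_pos S)
    (windowCutoff_pos R) (windowCutoff_antitone h) le_rfl q.1 ψ.2)

theorem LocalImages.continuous_stretch (N : ℕ) : Continuous (LocalImages.stretch N) := by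
  refine Continuous.subtype_mk (continuous_pi fun R => ?_) _
  exact (PathGerm.continuous_stretch N R).comp (continuous_fst.prodMk
    ((continuous_apply (R + 2)).comp (continuous_subtype_val.comp continuous_snd)))

/-! ### Local images with at most one point -/

/-- The path at the empty configuration. -/
def ConfPath.empty (X : Type) [TopologicalSpace X] : ConfPath 0 X :=
  ⟨⟨fun t => (t, UConf.mk ⟨Fin.elim0, fun i => i.elim0⟩), by fun_prop⟩, fun _ => rfl⟩

/-- The constant path at the configuration of one point. -/
def ConfPath.single {X : Type} [TopologicalSpace X] (x : X) : ConfPath 1 X :=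
  ⟨⟨fun t => (t, UConf.mk ⟨fun _ => x, Function.injective_of_subsingleton _⟩), by fun_prop⟩,
    fun _ => rfl⟩

theorem ConfPath.points_empty {X : Type} [TopologicalSpace X] (t : ℝ) :
    ((ConfPath.empty X).1 t).2.points = ∅ :=
  Set.range_eq_empty _

theorem ConfPath.points_single {X : Type} [TopologicalSpace X] (x : X) (t : ℝ) :
    ((ConfPath.single x).1 t).2.points = {x} :=
  Set.range_const

theorem ConfPath.continuous_single {X : Type} [TopologicalSpace X] :
    Continuous (ConfPath.single : X → ConfPath 1 X) := by
  refine Continuous.subtype_mk (ContinuousMap.continuous_of_continuous_uncurry _ ?_) _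
  refine continuous_snd.prodMk ((UConf.isOpenQuotientMap_mk 1 X).continuous.comp
    (f := fun q : X × ℝ => (⟨fun _ => q.1, Function.injective_of_subsingleton _⟩ : Conf 1 X)) ?_)
  exact Continuous.subtype_mk (continuous_pi fun _ => continuous_fst) _

/-- The constant path with at most one point, which is absent if it is at infinity. -/
def ConfPath.ofOnePoint {X : Type} [TopologicalSpace X] (p : OnePoint X) :
    Σ n : ℕ, ConfPath n X :=
  p.elim ⟨0, ConfPath.empty X⟩ fun x => ⟨1, ConfPath.single x⟩

theorem ConfPath.mem_points_ofOnePoint {X : Type} [TopologicalSpace X] {p : OnePoint X} {t : ℝ}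
    {x : X} : x ∈ ((ConfPath.ofOnePoint p).2.1 t).2.points ↔ p = x := by
  cases p using OnePoint.rec with
  | infty =>
    change x ∈ ((ConfPath.empty X).1 t).2.points ↔ _
    rw [ConfPath.points_empty]
    simp
  | coe y =>
    change x ∈ ((ConfPath.single y).1 t).2.points ↔ _
    rw [ConfPath.points_single, OnePoint.coe_eq_coe, eq_comm]
    rfl

/-- The local image of a constant path with at most one point. -/
def LocalImages.ofOnePoint (p : OnePoint (EuclideanSpace ℝ (Fin N))) : LocalImages N :=
  ⟨fun R => PathGerm.mk (window N R) (ConfPath.ofOnePoint p), fun _ _ _ => rfl⟩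

theorem LocalImages.continuous_ofOnePoint :
    Continuous (LocalImages.ofOnePoint (N := N)) := by
  refine Continuous.subtype_mk (continuous_pi fun R => ?_) _
  rw [OnePoint.continuous_iff]
  constructor
  · -- A point outside the window cannot be seen, so the map is constant near infinity.
    refine tendsto_const_nhds.congr' ?_
    filter_upwards [(isCompact_supNorm_le ((R : ℝ) / 2)).compl_mem_coclosedCompact_of_isClosed
      (isCompact_supNorm_le _).isClosed] with x hx
    refine PathGerm.mk_eq_mk.2 (Set.ext fun p => and_congr_left fun hp => ?_)
    rw [ConfPath.mem_image, ConfPath.mem_image, ConfPath.mem_points_ofOnePoint,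
      ConfPath.mem_points_ofOnePoint]
    refine iff_of_false (OnePoint.infty_ne_coe _) fun h => hx ?_
    rw [OnePoint.coe_injective h]
    exact (mem_window_iff.1 hp).2
  · exact (PathGerm.isQuotientMap_mk _).continuous.comp
      (continuous_sigmaMk.comp ConfPath.continuous_single)

/-! ### The isolated point of a local image -/

/-- The isolated point of a local image at time `0`. It is read off in the window of size `2`, whose
spatial part is the unit ball of the sup norm. -/
noncomputable def LocalImages.isolatedPoint (φ : LocalImages N) :
    OnePoint (EuclideanSpace ℝ (Fin N)) :=
  Quotient.lift (s := ConfPath.sameOn (window N 2))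
    (fun ψ => _root_.isolatedPoint (ψ.2.1 0).2.points)
    (fun _ _ h => isolatedPoint_congr fun x hx => ConfPath.mem_points_iff_of_sameOn h
      (by norm_num) (hx.trans (by norm_num))) (φ.1 2)

theorem LocalImages.continuous_isolatedPoint :
    Continuous (LocalImages.isolatedPoint (N := N)) := by
  have h : Continuous (Quotient.lift (s := ConfPath.sameOn (window N 2))
    (fun ψ => _root_.isolatedPoint (ψ.2.1 0).2.points)
    (fun _ _ h => isolatedPoint_congr fun x hx => ConfPath.mem_points_iff_of_sameOn h
      (by norm_num) (hx.trans (by norm_num)))) := by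
    refine continuous_quot_lift _ (continuous_sigma fun n => ?_)
    exact UConf.continuous_isolatedPoint.comp (continuous_snd.comp
      (continuous_subtype_val.eval continuous_const))
  exact h.comp ((continuous_apply 2).comp continuous_subtype_val)

theorem LocalImages.stretch_zero (φ : LocalImages N) : LocalImages.stretch N (0, φ) = φ := by
  refine Subtype.ext (funext fun R => ?_)
  obtain ⟨ψ, hψ⟩ := φ.exists_rep (R + 2)
  change PathGerm.stretch N R (0, φ.1 (R + 2)) = φ.1 R
  rw [hψ (R + 2) le_rfl, hψ R (by omega)]
  refine PathGerm.mk_eq_mk.2 ?_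
  change (ψ.2.stretch (windowCutoff_pos R) 0).image ∩ _ = _
  rw [ConfPath.stretch_zero _ (windowCutoff_le_one R)]

/-- At the end of the stretching only the isolated point is left, and it does not move. -/
theorem LocalImages.stretch_one (φ : LocalImages N) :
    LocalImages.stretch N (1, φ) = LocalImages.ofOnePoint φ.isolatedPoint := by
  refine Subtype.ext (funext fun R => ?_)
  obtain ⟨ψ, hψ⟩ := φ.exists_rep (R + 2)
  have hφ : φ.isolatedPoint = _root_.isolatedPoint (ψ.2.1 0).2.points := by
    rw [LocalImages.isolatedPoint, hψ 2 (by omega)]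
    rfl
  change PathGerm.stretch N R (1, φ.1 (R + 2)) = PathGerm.mk _ (ConfPath.ofOnePoint _)
  rw [hψ (R + 2) le_rfl, hφ]
  refine PathGerm.mk_eq_mk.2 (Set.ext fun p => and_congr_left fun hp => ?_)
  change p ∈ (ψ.2.stretch (windowCutoff_pos R) 1).image ↔ _
  have hδ := (ψ.2.1 0).2.separation_pos
  rw [ConfPath.mem_image_stretch, ConfPath.mem_image, ConfPath.mem_points_ofOnePoint,
    isolatedPoint_eq_coe_iff]
  simp only [Set.Icc.coe_one, sub_self, zero_mul]
  refine exists_congr fun x => and_congr_right fun _ => ?_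
  have hpw := (mem_window_iff.1 hp).2
  have hsub : (1 : ℝ) - 1 + 1 * (separation (ψ.2.1 0).2.points - supNorm x) =
    separation (ψ.2.1 0).2.points - supNorm x := by ring
  constructor
  · intro hx
    have h := windowCutoff_mul_le_of_supNorm_stretch_le (windowCutoff_pos R) le_rfl hδ
      (separation_le_one _) le_rfl (hx ▸ hpw)
    have h' := stretch_eq_of_le x h
    rw [hsub] at h h'
    exact ⟨(mul_pos (windowCutoff_pos R) hδ).trans_le h, h'.symm.trans hx⟩
  · rintro ⟨hpos, hx⟩
    have h := windowCutoff_mul_le (R := R) (τ := 1) (r := supNorm x)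
      (d := separation (ψ.2.1 0).2.points - supNorm x) hδ
      (separation_le_one _) le_rfl (supNorm_nonneg x) (hsub ▸ le_max_left _ _) (by
        rw [← hx, supNorm_smul, abs_of_pos (inv_pos.2 hpos), ← div_eq_inv_mul,
          div_le_iff₀ hpos] at hpw
        exact hpw)
    rw [stretch_eq_of_le x h, hsub, hx]

/-! ### The homotopy equivalence -/

/-- The radial map `x ↦ x / (1 - τ ‖x‖)`, with value `∞` where this is not defined. -/
noncomputable def blowUpAt (τ : ℝ) (x : EuclideanSpace ℝ (Fin N)) :
    OnePoint (EuclideanSpace ℝ (Fin N)) :=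
  if 0 < 1 - τ * supNorm x then ((1 - τ * supNorm x)⁻¹ • x : EuclideanSpace ℝ (Fin N)) else ∞

/-- The maps `blowUpAt τ`, extended by `∞ ↦ ∞`. They connect the identity, for `τ = 0`, with the map
which sends a point to the isolated point of the constant path there, for `τ = 1`. -/
noncomputable def blowUpHomotopy (N : ℕ) (q : I × OnePoint (EuclideanSpace ℝ (Fin N))) :
    OnePoint (EuclideanSpace ℝ (Fin N)) :=
  q.2.elim ∞ (blowUpAt q.1)

theorem continuous_blowUpHomotopy (N : ℕ) : Continuous (blowUpHomotopy N) := by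
  refine continuous_iff_continuousAt.2 ?_
  rintro ⟨τ, p⟩
  cases p using OnePoint.rec with
  | infty =>
    -- Near infinity the homotopy does not decrease norms.
    change Filter.Tendsto _ _ (𝓝 ∞)
    rw [OnePoint.tendsto_nhds_infty_iff_norm]
    intro M
    have h : Filter.Tendsto (fun q : I × OnePoint (EuclideanSpace ℝ (Fin N)) => q.2)
        (𝓝 (τ, ∞)) (𝓝 ∞) := continuous_snd.continuousAt
    filter_upwards [OnePoint.tendsto_nhds_infty_iff_norm.1 h M] with q hq y hy
    obtain ⟨τ', p⟩ := q
    cases p using OnePoint.rec with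
    | infty => exact absurd hy (OnePoint.infty_ne_coe y)
    | coe x =>
      change blowUpAt τ' x = y at hy
      rw [blowUpAt] at hy
      split_ifs at hy with hpos
      · refine (hq x rfl).trans_le ?_
        rw [← OnePoint.coe_injective hy, norm_smul, norm_inv, Real.norm_of_nonneg hpos.le]
        exact le_mul_of_one_le_left (norm_nonneg x) ((one_le_inv₀ hpos).2
          (sub_le_self 1 (mul_nonneg τ'.2.1 (supNorm_nonneg x))))
      · exact absurd hy (OnePoint.infty_ne_coe y)
  | coe x =>
    have hj : IsOpenEmbedding (Prod.map id (↑) :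
        I × EuclideanSpace ℝ (Fin N) → I × OnePoint (EuclideanSpace ℝ (Fin N))) :=
      IsOpenEmbedding.id.prodMap OnePoint.isOpenEmbedding_coe
    refine (hj.continuousAt_iff (x := (τ, x))).1 (Continuous.continuousAt ?_)
    refine OnePoint.continuous_inv_smul (w := fun q : I × EuclideanSpace ℝ (Fin N) =>
      1 - (q.1 : ℝ) * supNorm q.2) (by fun_prop) continuous_snd ?_
    rintro ⟨τ', x⟩ h rfl
    rw [supNorm_zero, mul_zero, sub_zero] at h
    exact one_ne_zero h

theorem blowUpHomotopy_zero (p : OnePoint (EuclideanSpace ℝ (Fin N))) :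
    blowUpHomotopy N (0, p) = p := by
  cases p using OnePoint.rec with
  | infty => rfl
  | coe x =>
    change blowUpAt 0 x = x
    simp [blowUpAt]

theorem blowUpHomotopy_one (p : OnePoint (EuclideanSpace ℝ (Fin N))) :
    blowUpHomotopy N (1, p) = (LocalImages.ofOnePoint p).isolatedPoint := by
  change _ = isolatedPoint ((ConfPath.ofOnePoint p).2.1 0).2.points
  have hsub : ((ConfPath.ofOnePoint p).2.1 0).2.points.Subsingleton := fun x hx y hy =>
    OnePoint.coe_injective ((ConfPath.mem_points_ofOnePoint.1 hx).symm.trans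
      (ConfPath.mem_points_ofOnePoint.1 hy))
  have hsep := separation_of_subsingleton hsub
  cases p using OnePoint.rec with
  | infty =>
    rw [isolatedPoint_eq_infty fun x hx =>
      absurd (ConfPath.mem_points_ofOnePoint.1 hx) (OnePoint.infty_ne_coe x)]
    rfl
  | coe x =>
    have hx : x ∈ ((ConfPath.ofOnePoint (x : OnePoint (EuclideanSpace ℝ (Fin N)))).2.1
      0).2.points := ConfPath.mem_points_ofOnePoint.2 rfl
    have hl : blowUpHomotopy N (1, x) = blowUp 1 x := by
      change blowUpAt 1 x = blowUp 1 x
      rw [blowUpAt, one_mul, blowUp]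
    rw [hl]
    rcases lt_or_ge (supNorm x) 1 with h | h
    · rw [isolatedPoint_eq_blowUp hx (hsep ▸ h), hsep]
    · rw [isolatedPoint_eq_infty fun y hy => ?_, blowUp, if_neg (not_lt.2 (sub_nonpos.2 h))]
      rwa [hsep, hsub hy hx]

/-- The isolated point is a homotopy equivalence, whose inverse sends a point to the constant path
at this point. -/
noncomputable def LocalImages.homotopyEquivOnePoint (N : ℕ) :
    ContinuousMap.HomotopyEquiv (LocalImages N) (OnePoint (EuclideanSpace ℝ (Fin N))) where
  toFun := ⟨LocalImages.isolatedPoint, LocalImages.continuous_isolatedPoint⟩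
  invFun := ⟨LocalImages.ofOnePoint, LocalImages.continuous_ofOnePoint⟩
  left_inv := ContinuousMap.Homotopic.symm
    ⟨⟨⟨LocalImages.stretch N, LocalImages.continuous_stretch N⟩, LocalImages.stretch_zero,
      LocalImages.stretch_one⟩⟩
  right_inv := ContinuousMap.Homotopic.symm
    ⟨⟨⟨blowUpHomotopy N, continuous_blowUpHomotopy N⟩, blowUpHomotopy_zero,
      blowUpHomotopy_one⟩⟩

end Maps

/-! ### The weak equivalence with the sphere -/

theorem mainTheorem5 (N : ℕ) :
    WeaklyEquivalent (LocalImages N)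
      (Metric.sphere (0 : EuclideanSpace ℝ (Fin (N + 1))) 1) := by
  let e := (LocalImages.homotopyEquivOnePoint N).trans
    (onePointEquivSphereOfFinrankEq (ι := Fin (N + 1)) (V := EuclideanSpace ℝ (Fin N))
      (by simp)).toHomotopyEquiv
  exact Relation.EqvGen.rel _ _ ⟨e.toFun, e.isWeakHomotopyEquiv⟩
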